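/- Let $(W,S)$ be a finite Coxeter system with length function $\ell$. For $I\subset S$ put $X_I=\{w\in W\mid \ell(ws)>\ell(w)\text{ for all }s\in I\}$ and $x_I=\sum_{w\in X_I}w\in\mathbb{Q}W$, and let $\Sigma(W)$ be the $\mathbb{Q}$-span of the $x_I$ ($I\subset S$) in $\mathbb{Q}W$. For $\mathcal F$ a set of subsets of $S$, let $\Sigma_{\mathcal F}(W)$ be the $\mathbb{Q}$-span of the $x_I$ with $I\in\mathcal F$. The $x_I$ $(I\subset S)$ are linearly independent and $\Sigma(W)$ is a unital subalgebra of $\mathbb{Q}W$ (the descent algebra; Solomon). Write $a=\sum_{I\subset S}\xi_I(a)x_I$ for $a\in\Sigma(W)$, and let $\Sigma^+(W)$ be the set of $a\in\Sigma(W)$ with $\xi_I(a)\geq 0$ for all $I\subset S$. For $I,J\subset S$ write $I\equiv J$ if $J=wIw^{-1}$ for some $w\in W$, let $\lambda(I)$ be the class of $I$ for this equivalence relation, and write $\lambda(I)\subset\lambda(J)$ if there are $I'\equiv I$ and $J'\equiv J$ with $I'\subset J'$. For $a\in\Sigma(W)$ let $$\mathcal F_{\mathrm{eq}}(a)=\{I\subset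 S\mid \text{there is } J\subset S \text{ with } \xi_J(a)\neq 0 \text{ and } \lambda(I)\subset\lambda(J)\}.$$ Then: 1. For every $a\in\Sigma^+(W)$, $a\Sigma(W)=\Sigma_{\mathcal F_{\mathrm{eq}}(a)}(W)$; in particular $\Sigma(W)a\subset a\Sigma(W)$. 2. An element $a\in\Sigma^+(W)$ is invertible in $\Sigma(W)$ if and only if $\xi_S(a)>0$. 3. If $a_1,\dots,a_r\in\Sigma^+(W)$, then $a_1+\dots+a_r\in\Sigma^+(W)$ and $a_1\Sigma(W)+\dots+a_r\Sigma(W)=(a_1+\dots+a_r)\Sigma(W)$. -/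

import Mathlib

noncomputable section

namespace DescentAlgebra

variable {B : Type*} {M : CoxeterMatrix B} {W : Type*} [Group W] (cs : CoxeterSystem M W)

/-- The set `S` of simple reflections, as a subset of `W`. -/
abbrev simples : Set W := Set.range cs.simple

/-- `X_I = {w ∈ W | ∀ s ∈ I, ws > w}`. As `s` is a reflection, `ws > w` in the Bruhat order means
that `ws` is longer than `w`. -/
def X (I : Set (simples cs)) : Set W :=
  {w | ∀ s ∈ I, cs.length w < cs.length (w * (s : W))}

/-- `x_I = ∑_{w ∈ X_I} w` in the rational group algebra of `W`. -/
def x [Finite W] (I : Set (simples cs)) : MonoidAlgebra ℚ W :=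
  ∑ w ∈ (Set.toFinite (X cs I)).toFinset, MonoidAlgebra.of ℚ W w

/-- `Σ_F(W)`, the span of the `x_I` with `I ∈ F`. -/
def spanOf [Finite W] (F : Set (Set (simples cs))) : Submodule ℚ (MonoidAlgebra ℚ W) :=
  Submodule.span ℚ (x cs '' F)

/-- The descent algebra `Σ(W)`, the span of all the `x_I`. -/
def descent [Finite W] : Submodule ℚ (MonoidAlgebra ℚ W) :=
  spanOf cs Set.univ

/-- Every element of `Σ(W)` is a linear combination of the `x_I`, and the coefficients can be
chosen linearly. -/
theorem exists_coords [Finite W] :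
    ∃ f : descent cs →ₗ[ℚ] (Set (simples cs) →₀ ℚ),
      ∀ a : descent cs, Finsupp.linearCombination ℚ (x cs) (f a) = (a : MonoidAlgebra ℚ W) := by
  have h : LinearMap.range (Finsupp.linearCombination ℚ (x cs)) = descent cs := by
    rw [Finsupp.range_linearCombination, descent, spanOf, Set.image_univ]
  obtain ⟨g, hg⟩ := LinearMap.exists_rightInverse_of_surjective
    (Finsupp.linearCombination ℚ (x cs)).rangeRestrict (LinearMap.range_rangeRestrict _)
  refine ⟨g ∘ₗ (LinearEquiv.ofEq _ _ h.symm).toLinearMap, fun a => ?_⟩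
  have := congrArg Subtype.val (LinearMap.congr_fun hg (LinearEquiv.ofEq _ _ h.symm a))
  simpa using this

/-- `ξ_I(a)`, the coefficient of `x_I` in `a ∈ Σ(W)`; see `sum_xi`. The coefficients are unique
because the `x_I` are linearly independent. -/
def xi [Finite W] (I : Set (simples cs)) (a : descent cs) : ℚ :=
  (exists_coords cs).choose a I

/-- The defining property `a = ∑_I ξ_I(a) x_I` of the coefficients. -/
theorem sum_xi [Finite W] [Fintype (Set (simples cs))] (a : descent cs) :
    ∑ I, xi cs I a • x cs I = (a : MonoidAlgebra ℚ W) := by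
  rw [← (exists_coords cs).choose_spec a, Finsupp.linearCombination_apply,
    Finsupp.sum_fintype _ _ (by simp)]
  rfl

/-- `Σ⁺(W)`, the elements of `Σ(W)` all of whose coefficients are non-negative. -/
def positive [Finite W] : Set (descent cs) :=
  {a | ∀ I, 0 ≤ xi cs I a}

/-- The relation `I ≡ J`: there is `w ∈ W` with `J = w I w⁻¹` (as subsets of `W`). -/
def conjSetoid : Setoid (Set (simples cs)) where
  r I J := ∃ w : W, Subtype.val '' J = MulAut.conj w '' (Subtype.val '' I)
  iseqv :=
    { refl := fun I => ⟨1, by simp⟩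
      symm := by
        rintro I J ⟨w, h⟩
        refine ⟨w⁻¹, ?_⟩
        rw [h, Set.image_image]
        simp [mul_assoc]
      trans := by
        rintro I J K ⟨w, h⟩ ⟨v, h'⟩
        refine ⟨v * w, ?_⟩
        rw [h', h, Set.image_image]
        simp [mul_assoc] }

/-- `Λ`, the set of classes of subsets of `S` under `≡`. -/
def Lam : Type _ := Quotient (conjSetoid cs)

/-- The canonical surjection from the subsets of `S` onto `Λ`. -/
def lam (I : Set (simples cs)) : Lam cs := Quotient.mk (conjSetoid cs) I

/-- The order on `Λ` induced by inclusion. -/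
def LamLE (p q : Lam cs) : Prop :=
  ∃ I J : Set (simples cs), lam cs I = p ∧ lam cs J = q ∧ I ⊆ J

/-- `F_eq(a)`, the equivariant saturation of the support of `a`. -/
def Feq [Finite W] (a : descent cs) : Set (Set (simples cs)) :=
  {I | ∃ J, xi cs J a ≠ 0 ∧ LamLE cs (lam cs I) (lam cs J)}

/-- `a Σ(W)`. -/
def rightIdeal [Finite W] (a : descent cs) : Submodule ℚ (MonoidAlgebra ℚ W) :=
  (descent cs).map (LinearMap.mulLeft ℚ (a : MonoidAlgebra ℚ W))

/-- `Σ(W) a`. -/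
def leftIdeal [Finite W] (a : descent cs) : Submodule ℚ (MonoidAlgebra ℚ W) :=
  (descent cs).map (LinearMap.mulRight ℚ (a : MonoidAlgebra ℚ W))

/-- `a` is invertible in `Σ(W)`. -/
def IsInvertible [Finite W] (a : descent cs) : Prop :=
  ∃ b : descent cs, (a : MonoidAlgebra ℚ W) * b = 1 ∧ (b : MonoidAlgebra ℚ W) * a = 1

end DescentAlgebra

end

namespace DescentAlgebra

variable {B : Type*} {M : CoxeterMatrix B} {W : Type*} [Group W] (cs : CoxeterSystem M W)

/-! By Solomon's formula (`x_mul_x`), `x_I x_J` is the sum of the `x_K` with `K = J ∩ d⁻¹Id`, over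
the distinguished double coset representatives `d`. Each `K` lies in `J` and is conjugate into `I`.
The second fact gives `aΣ(W) ⊆ Σ_F(W)` for `F = F_eq(a)`, and the first, applied to `x_J a`, gives
the same for `Σ(W)a`.

By the first fact also, left multiplication by `a` is triangular for inclusion. The diagonal
coefficient at `J` sums `ξ_I(a)` times the number of `d` with `J ∩ d⁻¹Id = J`. Such `d` exist when
`J` is conjugate into `I` (`exists_interConj_eq`), and for `a ∈ Σ⁺(W)` nothing cancels, so the
coefficient is positive on `F_eq(a)`. Induction on `J` yields equality (`x_mem_rightIdeal`).
Invertibility is the case `x_S = 1`; sums are handled by taking unions of supports.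

The Coxeter combinatorics rests on the cocycle `eta`, which detects inversions. -/

theorem end_mul_apply {α : Type*} (f g : Function.End α) (a : α) : (f * g) a = f (g a) := rfl

/-! ### The inversion cocycle -/

open scoped Classical in
/-- The permutation `(t, ε) ↦ (sts⁻¹, ε + [t = s])` attached to a simple reflection `s`. -/
noncomputable def twist (i : B) : Function.End (W × ZMod 2) :=
  fun p => (cs.simple i * p.1 * (cs.simple i)⁻¹, p.2 + if p.1 = cs.simple i then 1 else 0)

open scoped Classical in
theorem twist_mul_pow_apply (i j : B) (n : ℕ) (p : W × ZMod 2) :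
    ((twist cs i * twist cs j) ^ n) p =
      ((cs.simple i * cs.simple j) ^ n * p.1 * ((cs.simple i * cs.simple j) ^ n)⁻¹,
        p.2 + ∑ k ∈ Finset.range (2 * n),
          if p.1 = ((cs.simple i * cs.simple j) ^ k)⁻¹ * cs.simple j then 1 else 0) := by
  set r := cs.simple i * cs.simple j with hr
  have hri : r⁻¹ = cs.simple j * cs.simple i := by simp [hr]
  have hconj (k : ℕ) : cs.simple j * r ^ k = (r ^ k)⁻¹ * cs.simple j := by
    have h : SemiconjBy (cs.simple j) r r⁻¹ := by
      rw [SemiconjBy, hri, hr, mul_assoc]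
    rw [← inv_pow]
    exact h.pow_right k
  induction n with
  | zero => simp; rfl
  | succ n ih =>
    have h1 : r ^ n * p.1 * (r ^ n)⁻¹ = cs.simple j ↔ p.1 = (r ^ (2 * n))⁻¹ * cs.simple j := by
      rw [two_mul, pow_add, mul_inv_rev, mul_assoc _ _ (cs.simple j), ← hconj, mul_inv_eq_iff_eq_mul,
        eq_inv_mul_iff_mul_eq]
    have h2 : cs.simple j * (r ^ n * p.1 * (r ^ n)⁻¹) * (cs.simple j)⁻¹ = cs.simple i ↔
        p.1 = (r ^ (2 * n + 1))⁻¹ * cs.simple j := by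
      have e : 2 * n + 1 = n + 1 + n := by ring
      rw [e, pow_add, mul_inv_rev, mul_assoc _ _ (cs.simple j), ← hconj, eq_inv_mul_iff_mul_eq,
        pow_succ', mul_inv_eq_iff_eq_mul, ← hr, ← eq_inv_mul_iff_mul_eq, mul_inv_eq_iff_eq_mul,
        CoxeterSystem.inv_simple, hr]
      simp only [mul_assoc]
    rw [pow_succ', end_mul_apply, ih, end_mul_apply, mul_add_one, Finset.sum_range_succ, Finset.sum_range_succ]
    refine Prod.ext ?_ ?_
    · simp [twist, pow_succ', hr, mul_assoc]
    · simp only [twist, h1, h2, add_assoc]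

theorem twist_isLiftable : M.IsLiftable (twist cs) := by
  classical
  intro i j
  funext p
  -- The summand has period `M i j`, so the two halves of the sum cancel in characteristic 2.
  rw [twist_mul_pow_apply, cs.simple_mul_simple_pow, two_mul, Finset.sum_range_add]
  simp only [pow_add, cs.simple_mul_simple_pow, one_mul, CharTwo.add_self_eq_zero]
  simp
  rfl

/-- The action of `W` on `W × ℤ/2` extending `twist`. -/
noncomputable def twistHom : W →* Function.End (W × ZMod 2) :=
  cs.lift ⟨twist cs, twist_isLiftable cs⟩

/-- The parity of the number of occurrences of `t` in the right inversion sequence of any word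
for `w`. -/
noncomputable def eta (w t : W) : ZMod 2 := (twistHom cs w (t, 0)).2

theorem twistHom_simple (i : B) : twistHom cs (cs.simple i) = twist cs i :=
  cs.lift_apply_simple (twist_isLiftable cs) i

theorem twistHom_apply (w t : W) (ε : ZMod 2) :
    twistHom cs w (t, ε) = (w * t * w⁻¹, ε + eta cs w t) := by
  induction w using cs.simple_induction_left generalizing ε with
  | one => simp [eta]; simp [Function.End.one_def]
  | mul_simple_left w i ih =>
    have h (ε : ZMod 2) : twistHom cs (cs.simple i * w) (t, ε) =
        twist cs i (w * t * w⁻¹, ε + eta cs w t) := by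
      rw [map_mul, end_mul_apply, twistHom_simple, ih]
    rw [eta, h, h]
    simp [twist, mul_assoc, add_assoc]

theorem eta_mul (v w t : W) : eta cs (v * w) t = eta cs w t + eta cs v (w * t * w⁻¹) := by
  have h : twistHom cs (v * w) (t, 0) = twistHom cs v (twistHom cs w (t, 0)) := by
    rw [map_mul, end_mul_apply]
  simp only [twistHom_apply, zero_add] at h
  exact congrArg Prod.snd h

@[simp]
theorem eta_one (t : W) : eta cs 1 t = 0 := by
  have := eta_mul cs 1 1 t
  simpa using this

open scoped Classical in
theorem eta_simple (i : B) (t : W) : eta cs (cs.simple i) t = if t = cs.simple i then 1 else 0 := by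
  simp [eta, twistHom_simple, twist]

theorem eta_inv (w t : W) : eta cs w⁻¹ t = eta cs w (w⁻¹ * t * w) := by
  have h := eta_mul cs w w⁻¹ t
  rw [mul_inv_cancel, eta_one, inv_inv] at h
  exact CharTwo.add_eq_zero.1 h.symm

theorem mem_rightInvSeq_of_eta_ne_zero {ω : List B} {t : W} (h : eta cs (cs.wordProd ω) t ≠ 0) :
    t ∈ cs.rightInvSeq ω := by
  classical
  induction ω with
  | nil => simp at h
  | cons i ω ih =>
    rw [cs.wordProd_cons, eta_mul, eta_simple] at h
    rw [CoxeterSystem.rightInvSeq, List.mem_cons]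
    by_cases h' : eta cs (cs.wordProd ω) t = 0
    · left
      rw [h', zero_add] at h
      have := (ite_ne_right_iff.1 h).1
      rw [← this]
      group
    · exact Or.inr (ih h')

theorem isRightInversion_of_eta_ne_zero {w t : W} (h : eta cs w t ≠ 0) :
    cs.IsRightInversion w t := by
  obtain ⟨ω, hω, rfl⟩ := cs.exists_isReduced w
  exact cs.isRightInversion_of_mem_rightInvSeq hω (mem_rightInvSeq_of_eta_ne_zero cs h)

theorem eta_self {t : W} (ht : cs.IsReflection t) : eta cs t t = 1 := by
  obtain ⟨w, i, rfl⟩ := ht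
  have h : eta cs (w * cs.simple i * w⁻¹) (w * cs.simple i * w⁻¹) =
      eta cs w (cs.simple i) + (1 + eta cs w (cs.simple i)) := by
    rw [eta_mul, eta_inv, eta_mul, eta_simple]
    simp [mul_assoc]
  rw [h, add_left_comm, CharTwo.add_self_eq_zero, add_zero]

/-- The cocycle identity makes `eta` differ by 1 between `w` and `wt`, so it is nonzero at exactly
one of them, and a nonzero value forces an inversion. -/
theorem eta_eq_zero_iff {w t : W} (ht : cs.IsReflection t) :
    eta cs w t = 0 ↔ cs.length w < cs.length (w * t) := by
  constructor
  · intro h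
    have h1 : eta cs (w * t) t ≠ 0 := by
      rw [eta_mul, eta_self cs ht, mul_inv_cancel_right, h]
      decide
    have := (isRightInversion_of_eta_ne_zero cs h1).2
    rwa [mul_assoc, ht.mul_self, mul_one] at this
  · intro h
    by_contra h'
    exact lt_asymm h (isRightInversion_of_eta_ne_zero cs h').2

theorem isReflection_coe (s : simples cs) : cs.IsReflection (s : W) := by
  obtain ⟨i, hi⟩ := s.2
  exact hi ▸ cs.isReflection_simple i

theorem coe_ne_one (s : simples cs) : (s : W) ≠ 1 := by
  obtain ⟨i, hi⟩ := s.2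
  intro h
  have := cs.length_simple i
  rw [hi, h, cs.length_one] at this
  exact zero_ne_one this

open scoped Classical in
theorem eta_coe (s : simples cs) (t : W) : eta cs s t = if t = s then 1 else 0 := by
  obtain ⟨i, hi⟩ := s.2
  rw [← hi, eta_simple]

theorem eta_coe_ne_zero_iff (s : simples cs) (t : W) : eta cs s t ≠ 0 ↔ t = s := by
  classical
  rw [eta_coe]
  simp

theorem mem_X_iff {I : Set (simples cs)} {w : W} : w ∈ X cs I ↔ ∀ s ∈ I, eta cs w s = 0 :=
  forall₂_congr fun s _ => (eta_eq_zero_iff cs (isReflection_coe cs s)).symm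

/-! ### Parabolic subgroups and coset representatives -/

/-- The standard parabolic subgroup `W_I`. -/
def parabolic (I : Set (simples cs)) : Subgroup W := Subgroup.closure (Subtype.val '' I)

theorem coe_mem_parabolic {I : Set (simples cs)} {s : simples cs} (hs : s ∈ I) :
    (s : W) ∈ parabolic cs I :=
  Subgroup.subset_closure ⟨s, hs, rfl⟩

theorem mem_parabolic_of_eta_ne_zero {I : Set (simples cs)} {u t : W} (hu : u ∈ parabolic cs I)
    (h : eta cs u t ≠ 0) : t ∈ parabolic cs I := by
  induction hu using Subgroup.closure_induction generalizing t with
  | mem x hx =>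
    obtain ⟨s, hs, rfl⟩ := hx
    rw [(eta_coe_ne_zero_iff cs s t).1 h]
    exact coe_mem_parabolic cs hs
  | one => simp at h
  | mul v w hv hw ihv ihw =>
    by_cases h' : eta cs w t = 0
    · rw [eta_mul, h', zero_add] at h
      have := ihv h
      rwa [parabolic, Subgroup.mul_mem_cancel_right _ (inv_mem hw), Subgroup.mul_mem_cancel_left _ hw] at this
    · exact ihw h'
  | inv w hw ih =>
    rw [eta_inv] at h
    have := ih h
    rwa [parabolic, Subgroup.mul_mem_cancel_right _ hw, Subgroup.mul_mem_cancel_left _ (inv_mem hw)] at this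

theorem exists_wordProd_of_mem_parabolic {I : Set (simples cs)} {u : W}
    (hu : u ∈ parabolic cs I) :
    ∃ ω : List B, (∀ i ∈ ω, (⟨cs.simple i, i, rfl⟩ : simples cs) ∈ I) ∧ cs.wordProd ω = u := by
  induction hu using Subgroup.closure_induction with
  | mem x hx =>
    obtain ⟨⟨_, i, rfl⟩, hs, rfl⟩ := hx
    exact ⟨[i], by simpa using hs, by simp⟩
  | one => exact ⟨[], by simp⟩
  | mul v w _ _ ihv ihw =>
    obtain ⟨ω, h, rfl⟩ := ihv
    obtain ⟨ω', h', rfl⟩ := ihw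
    refine ⟨ω ++ ω', fun i hi => ?_, cs.wordProd_append ω ω'⟩
    exact (List.mem_append.1 hi).elim (h i) (h' i)
  | inv w _ ih =>
    obtain ⟨ω, h, rfl⟩ := ih
    exact ⟨ω.reverse, fun i hi => h i (List.mem_reverse.1 hi), cs.wordProd_reverse ω⟩

/-- A nontrivial element of `W_I` has a right descent in `I`. -/
theorem exists_eta_ne_zero {I : Set (simples cs)} {u : W} (hu : u ∈ parabolic cs I)
    (h1 : u ≠ 1) : ∃ s ∈ I, eta cs u s ≠ 0 := by
  obtain ⟨ω, hω, hmin⟩ := WellFounded.has_min (measure (List.length (α := B))).wf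
    {ω | (∀ i ∈ ω, (⟨cs.simple i, i, rfl⟩ : simples cs) ∈ I) ∧ cs.wordProd ω = u}
    (exists_wordProd_of_mem_parabolic cs hu)
  obtain ⟨hI, rfl⟩ := hω
  obtain rfl | ⟨ω', i, rfl⟩ := List.eq_nil_or_concat ω
  · simp at h1
  · refine ⟨_, hI i (by simp), ?_⟩
    rw [cs.wordProd_concat, eta_mul,
      eta_self cs (cs.isReflection_simple i), mul_inv_cancel_right]
    -- Otherwise the exchange property deletes a letter of `ω'` and gives a shorter word for the
    -- same element with letters in `I`.
    have h0 : eta cs (cs.wordProd ω') (cs.simple i) = 0 := by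
      by_contra h
      obtain ⟨j, hj, hji⟩ := List.mem_iff_getElem.1 (mem_rightInvSeq_of_eta_ne_zero cs h)
      have he := cs.wordProd_mul_getD_rightInvSeq ω' j
      rw [List.getD_eq_getElem _ 1 hj, hji] at he
      refine hmin (ω'.eraseIdx j) ⟨fun k hk => hI k ?_, ?_⟩ ?_
      · exact List.concat_eq_append ▸ List.mem_append_left _ (List.mem_of_mem_eraseIdx hk)
      · rw [← he, cs.wordProd_concat]
      · change (ω'.eraseIdx j).length < (ω'.concat i).length
        have := List.length_eraseIdx_le ω' j
        simp
        omega
    rw [h0]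
    decide

theorem eq_one_of_mem_parabolic_of_mem_X {I : Set (simples cs)} {u : W}
    (hu : u ∈ parabolic cs I) (h : u ∈ X cs I) : u = 1 := by
  by_contra h1
  obtain ⟨s, hs, h'⟩ := exists_eta_ne_zero cs hu h1
  exact h' ((mem_X_iff cs).1 h s hs)

/-- Every element of `W` factors through `X_I` and `W_I`. The first factor has no right inversion
in `W_I`. -/
theorem exists_factorization (I : Set (simples cs)) (w : W) :
    ∃ a u, (∀ t ∈ parabolic cs I, eta cs a t = 0) ∧ u ∈ parabolic cs I ∧ w = a * u := by
  -- The factor `a` is an element of minimal length in the coset `wW_I`.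
  obtain ⟨a, ha, hmin⟩ := WellFounded.has_min (measure cs.length).wf
    {a | a⁻¹ * w ∈ parabolic cs I} ⟨w, by simp⟩
  refine ⟨a, a⁻¹ * w, fun t ht => ?_, ha, by simp⟩
  by_contra h
  refine hmin (a * t) ?_ (isRightInversion_of_eta_ne_zero cs h).2
  change (a * t)⁻¹ * w ∈ parabolic cs I
  rw [mul_inv_rev, mul_assoc]
  exact mul_mem (inv_mem ht) ha

/-- Passes from simple reflections to all of `W_I`: in a factorization `a = bu`, the factor `u` has
no descent in `I`, hence is trivial. -/
theorem eta_eq_zero_of_mem_X {I : Set (simples cs)} {a t : W} (ha : a ∈ X cs I)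
    (ht : t ∈ parabolic cs I) : eta cs a t = 0 := by
  obtain ⟨b, u, hb, hu, rfl⟩ := exists_factorization cs I a
  have h1 : u = 1 := by
    refine eq_one_of_mem_parabolic_of_mem_X cs hu ((mem_X_iff cs).2 fun s hs => ?_)
    have := (mem_X_iff cs).1 ha s hs
    rwa [eta_mul, hb _ (mul_mem (mul_mem hu (coe_mem_parabolic cs hs)) (inv_mem hu)),
      add_zero] at this
  rw [h1, mul_one]
  exact hb t ht

theorem eta_mul_of_mem_X {I : Set (simples cs)} {a u t : W} (ha : a ∈ X cs I)
    (hu : u ∈ parabolic cs I) (ht : t ∈ parabolic cs I) : eta cs (a * u) t = eta cs u t := by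
  rw [eta_mul, eta_eq_zero_of_mem_X cs ha (mul_mem (mul_mem hu ht) (inv_mem hu)), add_zero]

theorem factorization_unique {I : Set (simples cs)} {a b u v : W} (ha : a ∈ X cs I)
    (hb : b ∈ X cs I) (hu : u ∈ parabolic cs I) (hv : v ∈ parabolic cs I) (h : a * u = b * v) :
    a = b ∧ u = v := by
  have hm : u * v⁻¹ ∈ parabolic cs I := mul_mem hu (inv_mem hv)
  have e : b = a * (u * v⁻¹) := by rw [← mul_assoc, h, mul_inv_cancel_right]
  have h1 : u * v⁻¹ = 1 := by
    refine eq_one_of_mem_parabolic_of_mem_X cs hm ((mem_X_iff cs).2 fun s hs => ?_)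
    rw [← eta_mul_of_mem_X cs ha hm (coe_mem_parabolic cs hs), ← e]
    exact (mem_X_iff cs).1 hb s hs
  exact ⟨by rw [e, h1, mul_one], mul_inv_eq_one.1 h1⟩

theorem exists_mem_X_mul (I : Set (simples cs)) (w : W) :
    ∃ p : W × W, p.1 ∈ X cs I ∧ p.2 ∈ parabolic cs I ∧ p.1 * p.2 = w := by
  obtain ⟨a, u, ha, hu, rfl⟩ := exists_factorization cs I w
  exact ⟨(a, u), (mem_X_iff cs).2 fun s hs => ha s (coe_mem_parabolic cs hs), hu, rfl⟩

/-- The factor of `w` in `X_I`. -/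
noncomputable def cosetRep (I : Set (simples cs)) (w : W) : W := (exists_mem_X_mul cs I w).choose.1

/-- The factor of `w` in `W_I`. -/
noncomputable def parabolicPart (I : Set (simples cs)) (w : W) : W := (exists_mem_X_mul cs I w).choose.2

theorem cosetRep_mem (I : Set (simples cs)) (w : W) : cosetRep cs I w ∈ X cs I :=
  (exists_mem_X_mul cs I w).choose_spec.1

theorem parabolicPart_mem (I : Set (simples cs)) (w : W) :
    parabolicPart cs I w ∈ parabolic cs I :=
  (exists_mem_X_mul cs I w).choose_spec.2.1

theorem cosetRep_mul_parabolicPart (I : Set (simples cs)) (w : W) :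
    cosetRep cs I w * parabolicPart cs I w = w :=
  (exists_mem_X_mul cs I w).choose_spec.2.2

theorem cosetRep_mul {I : Set (simples cs)} {a u : W} (ha : a ∈ X cs I)
    (hu : u ∈ parabolic cs I) : cosetRep cs I (a * u) = a :=
  (factorization_unique cs (cosetRep_mem cs I _) ha (parabolicPart_mem cs I _) hu
    (cosetRep_mul_parabolicPart cs I _)).1

theorem parabolicPart_mul {I : Set (simples cs)} {a u : W} (ha : a ∈ X cs I)
    (hu : u ∈ parabolic cs I) : parabolicPart cs I (a * u) = u :=
  (factorization_unique cs (cosetRep_mem cs I _) ha (parabolicPart_mem cs I _) hu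
    (cosetRep_mul_parabolicPart cs I _)).2

/-! ### Double cosets -/

/-- The distinguished representatives of the double cosets `W_I \ W / W_J`. -/
def doubleReps (I J : Set (simples cs)) : Set W := {d | d⁻¹ ∈ X cs I ∧ d ∈ X cs J}

/-- The set of simple reflections `J ∩ d⁻¹Id`. -/
def interConj (I J : Set (simples cs)) (d : W) : Set (simples cs) :=
  {s | s ∈ J ∧ ∃ t ∈ I, (t : W) = d * s * d⁻¹}

theorem interConj_subset (I J : Set (simples cs)) (d : W) : interConj cs I J d ⊆ J :=
  fun _ h => h.1

/-- A descent `t ∈ I` of `dsd⁻¹` is an inversion of `sd⁻¹` but not of `d⁻¹`, so the cocycle identity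
forces `d⁻¹td = s`. -/
theorem exists_mem_of_conj_mem_parabolic {I : Set (simples cs)} {d : W} (hd : d⁻¹ ∈ X cs I)
    {s : simples cs} (hs : d * s * d⁻¹ ∈ parabolic cs I) : ∃ t ∈ I, (t : W) = d * s * d⁻¹ := by
  have h1 : d * s * d⁻¹ ≠ 1 := by
    rw [Ne, conj_eq_one_iff]
    exact coe_ne_one cs s
  obtain ⟨t, ht, h⟩ := exists_eta_ne_zero cs hs h1
  refine ⟨t, ht, ?_⟩
  rw [← eta_mul_of_mem_X cs hd hs (coe_mem_parabolic cs ht)] at h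
  have e : d⁻¹ * (d * s * d⁻¹) = s * d⁻¹ := by group
  rw [e, eta_mul, (mem_X_iff cs).1 hd t ht, zero_add, eta_coe_ne_zero_iff, inv_inv] at h
  rw [← h]
  group

theorem eta_mul_doubleRep {I J : Set (simples cs)} {d : W} (hd : d ∈ doubleReps cs I J) (u : W)
    {s : simples cs} (hs : s ∈ J) : eta cs (u * d) s = eta cs u (d * s * d⁻¹) := by
  rw [eta_mul, (mem_X_iff cs).1 hd.2 s hs, zero_add]

/-- A descent `s ∈ J` of `d` could only be cancelled by `u` at `dsd⁻¹`, which would then be an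
inversion of `d⁻¹` in `W_I`. -/
theorem mem_doubleReps_of_mul_mem_X {I J : Set (simples cs)} {u d : W} (hd : d⁻¹ ∈ X cs I)
    (hu : u ∈ parabolic cs I) (h : u * d ∈ X cs J) : d ∈ doubleReps cs I J := by
  refine ⟨hd, (mem_X_iff cs).2 fun s hs => ?_⟩
  by_contra h0
  have h1 := (mem_X_iff cs).1 h s hs
  rw [eta_mul] at h1
  have h2 : eta cs u (d * s * d⁻¹) ≠ 0 := fun h2 => h0 (by rwa [h2, add_zero] at h1)
  have h3 := eta_eq_zero_of_mem_X cs hd (mem_parabolic_of_eta_ne_zero cs hu h2)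
  rw [eta_inv] at h3
  refine h0 (h3 ▸ congrArg _ ?_)
  group

/-- For `a ∈ X_I` and `u ∈ W_I`, the conditions for `ud ∈ X_J` and for `aud ∈ X_K` with
`K = J ∩ d⁻¹Id` agree. -/
theorem mul_mem_X_interConj_iff {I J : Set (simples cs)} {a u d : W} (ha : a ∈ X cs I)
    (hu : u ∈ parabolic cs I) (hd : d ∈ doubleReps cs I J) :
    a * u * d ∈ X cs (interConj cs I J d) ↔ u * d ∈ X cs J := by
  have key {s : simples cs} (hs : s ∈ interConj cs I J d) :
      eta cs (a * u * d) s = eta cs (u * d) s := by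
    obtain ⟨hsJ, t, ht, e⟩ := hs
    rw [eta_mul_doubleRep cs hd _ hsJ, eta_mul_doubleRep cs hd _ hsJ, ← e,
      eta_mul_of_mem_X cs ha hu (coe_mem_parabolic cs ht)]
  simp only [mem_X_iff]
  constructor
  · intro h s hs
    by_contra h0
    have h1 := h0
    rw [eta_mul_doubleRep cs hd _ hs] at h1
    have hs' : s ∈ interConj cs I J d :=
      ⟨hs, exists_mem_of_conj_mem_parabolic cs hd.1 (mem_parabolic_of_eta_ne_zero cs hu h1)⟩
    exact h0 (key hs' ▸ h s hs')
  · intro h s hs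
    rw [key hs]
    exact h s hs.1

/-! ### Conjugacy of subsets of `S` -/

/-- `I` is conjugate to a subset of `J`. -/
def SubConj (I J : Set (simples cs)) : Prop :=
  ∃ g : W, ∀ s ∈ I, ∃ t ∈ J, (t : W) = g * s * g⁻¹

theorem lamLE_iff {I J : Set (simples cs)} : LamLE cs (lam cs I) (lam cs J) ↔ SubConj cs I J := by
  constructor
  · rintro ⟨I', J', hI, hJ, hsub⟩
    obtain ⟨g, hg⟩ : ∃ g : W, Subtype.val '' I' = MulAut.conj g '' (Subtype.val '' I) :=
      Quotient.exact hI.symm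
    obtain ⟨h, hh⟩ : ∃ h : W, Subtype.val '' J = MulAut.conj h '' (Subtype.val '' J') :=
      Quotient.exact hJ
    refine ⟨h * g, fun s hs => ?_⟩
    obtain ⟨s', hs', e⟩ : g * s * g⁻¹ ∈ Subtype.val '' I' := by
      rw [hg]
      exact ⟨s, ⟨s, hs, rfl⟩, rfl⟩
    obtain ⟨t, ht, e'⟩ : h * s' * h⁻¹ ∈ Subtype.val '' J := by
      rw [hh]
      exact ⟨s', ⟨s', hsub hs', rfl⟩, rfl⟩
    exact ⟨t, ht, by rw [e', e, mul_inv_rev]; simp only [mul_assoc]⟩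
  · rintro ⟨g, hg⟩
    refine ⟨{t | ∃ s ∈ I, (t : W) = g * s * g⁻¹}, J, ?_, rfl, ?_⟩
    · refine Quotient.sound (Setoid.symm' _ ⟨g, ?_⟩)
      ext w
      constructor
      · rintro ⟨t, ⟨s, hs, e⟩, rfl⟩
        exact ⟨s, ⟨s, hs, rfl⟩, e.symm⟩
      · rintro ⟨_, ⟨s, hs, rfl⟩, rfl⟩
        obtain ⟨t, -, e⟩ := hg s hs
        exact ⟨t, ⟨s, hs, e⟩, e⟩
    · rintro t ⟨s, hs, e⟩
      obtain ⟨t', ht', e'⟩ := hg s hs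
      rwa [Subtype.ext (e.trans e'.symm)]

theorem SubConj.mono_left {cs : CoxeterSystem M W} {I I' J : Set (simples cs)}
    (h : SubConj cs I J) (hI : I' ⊆ I) : SubConj cs I' J :=
  h.imp fun _ hg s hs => hg s (hI hs)

theorem subConj_of_subset {I J : Set (simples cs)} (h : I ⊆ J) : SubConj cs I J :=
  ⟨1, fun s hs => ⟨s, h hs, by simp⟩⟩

theorem subConj_interConj (I J : Set (simples cs)) (d : W) :
    SubConj cs (interConj cs I J d) I :=
  ⟨d, fun _ hs => hs.2⟩

/-- Stripping a conjugating element of its right factor in `W_J` and then its left factor in `W_I`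
leaves a distinguished `d` that still conjugates `W_J` into `W_I`. -/
theorem exists_interConj_eq {I J : Set (simples cs)} (h : SubConj cs J I) :
    ∃ d ∈ doubleReps cs I J, interConj cs I J d = J := by
  obtain ⟨g, hg⟩ := h
  have hconj : parabolic cs J ≤ (parabolic cs I).comap (MulAut.conj g).toMonoidHom := by
    refine (Subgroup.closure_le _).2 ?_
    rintro _ ⟨s, hs, rfl⟩
    obtain ⟨t, ht, e⟩ := hg s hs
    change g * s * g⁻¹ ∈ parabolic cs I
    exact e ▸ coe_mem_parabolic cs ht
  obtain ⟨⟨b, v⟩, hb, hv, rfl⟩ := exists_mem_X_mul cs J g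
  obtain ⟨⟨c, u⟩, hc, hu, e⟩ := exists_mem_X_mul cs I b⁻¹
  dsimp only at hb hv hc hu e hconj
  have hb' : b = u⁻¹ * c⁻¹ := by rw [← mul_inv_rev, e, inv_inv]
  have hd : c⁻¹ ∈ doubleReps cs I J :=
    mem_doubleReps_of_mul_mem_X cs (by rwa [inv_inv]) (inv_mem hu) (hb' ▸ hb)
  refine ⟨c⁻¹, hd, (interConj_subset cs I J _).antisymm fun s hs => ⟨hs, ?_⟩⟩
  refine exists_mem_of_conj_mem_parabolic cs hd.1 ?_
  have h1 : b * v * (v⁻¹ * s * v) * (b * v)⁻¹ ∈ parabolic cs I :=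
    hconj (mul_mem (mul_mem (inv_mem hv) (coe_mem_parabolic cs hs)) hv)
  have h2 := mul_mem (mul_mem hu h1) (inv_mem hu)
  rw [hb'] at h2
  convert h2 using 1
  group

/-! ### Solomon's formula -/

section Finite

variable [Finite W]

/-- Solomon's multiplication formula. -/
theorem x_mul_x (I J : Set (simples cs)) :
    x cs I * x cs J =
      ∑ d ∈ (Set.toFinite (doubleReps cs I J)).toFinset, x cs (interConj cs I J d) := by
  simp only [x]
  rw [Finset.sum_mul_sum, ← Finset.sum_product', Finset.sum_sigma']
  simp only [← map_mul]
  -- Write `b = ud` with `u ∈ W_I` and `d⁻¹ ∈ X_I`, and send `(a, b)` to `(d, aud)`. The inverse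
  -- recovers `a` and `u` by factoring `vd⁻¹ = au`.
  refine Finset.sum_bij' (fun p _ => ⟨(cosetRep cs I p.2⁻¹)⁻¹, p.1 * p.2⟩)
    (fun q _ => (cosetRep cs I (q.2 * q.1⁻¹), parabolicPart cs I (q.2 * q.1⁻¹) * q.1))
    ?_ ?_ ?_ ?_ ?_
  · rintro ⟨a, b⟩ h
    simp only [Finset.mem_product, Finset.mem_sigma, Set.Finite.mem_toFinset] at h ⊢
    obtain ⟨c, u, hc, hu, rfl⟩ : ∃ c u, c ∈ X cs I ∧ u ∈ parabolic cs I ∧ b = u * c⁻¹ := by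
      refine ⟨_, (parabolicPart cs I b⁻¹)⁻¹, cosetRep_mem cs I b⁻¹,
        inv_mem (parabolicPart_mem cs I b⁻¹), ?_⟩
      rw [← mul_inv_rev, cosetRep_mul_parabolicPart, inv_inv]
    have hd := mem_doubleReps_of_mul_mem_X cs (d := c⁻¹) (by rwa [inv_inv]) hu h.2
    rw [mul_inv_rev, inv_inv, cosetRep_mul cs hc (inv_mem hu), ← mul_assoc]
    exact ⟨hd, (mul_mem_X_interConj_iff cs h.1 hu hd).2 h.2⟩
  · rintro ⟨d, v⟩ h
    simp only [Finset.mem_product, Finset.mem_sigma, Set.Finite.mem_toFinset] at h ⊢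
    refine ⟨cosetRep_mem cs I _, (mul_mem_X_interConj_iff cs (cosetRep_mem cs I (v * d⁻¹))
      (parabolicPart_mem cs I _) h.1).1 ?_⟩
    rw [cosetRep_mul_parabolicPart, inv_mul_cancel_right]
    exact h.2
  · rintro ⟨a, b⟩ h
    simp only [Finset.mem_product, Set.Finite.mem_toFinset] at h
    have hu := inv_mem (parabolicPart_mem cs I b⁻¹)
    have e : b * cosetRep cs I b⁻¹ = (parabolicPart cs I b⁻¹)⁻¹ := by
      apply eq_inv_of_mul_eq_one_left
      rw [mul_assoc, cosetRep_mul_parabolicPart, mul_inv_cancel]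
    simp only [inv_inv]
    rw [mul_assoc, e, cosetRep_mul cs h.1 hu, parabolicPart_mul cs h.1 hu, ← e,
      mul_inv_cancel_right]
  · rintro ⟨d, v⟩ h
    simp only [Finset.mem_sigma, Set.Finite.mem_toFinset] at h
    have h1 : cosetRep cs I (parabolicPart cs I (v * d⁻¹) * d)⁻¹ = d⁻¹ := by
      rw [mul_inv_rev]
      exact cosetRep_mul cs h.1.1 (inv_mem (parabolicPart_mem cs I _))
    simp only [h1, inv_inv]
    rw [← mul_assoc, cosetRep_mul_parabolicPart, inv_mul_cancel_right]
  · simp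

noncomputable instance : Fintype (Set (simples cs)) := Fintype.ofFinite _

/-- The coefficient of `x_K` in `x_I x_J`. -/
noncomputable def mulCoeff (I J K : Set (simples cs)) : ℕ :=
  {d | d ∈ doubleReps cs I J ∧ interConj cs I J d = K}.ncard

theorem x_mul_x_eq_sum_mulCoeff (I J : Set (simples cs)) :
    x cs I * x cs J = ∑ K, mulCoeff cs I J K • x cs K := by
  classical
  rw [x_mul_x, ← Finset.sum_fiberwise _ (interConj cs I J)]
  refine Finset.sum_congr rfl fun K _ => ?_
  rw [Finset.sum_congr rfl fun d hd => by rw [(Finset.mem_filter.1 hd).2], Finset.sum_const,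
    mulCoeff, ← Set.ncard_coe_finset]
  congr 2
  ext d
  simp

theorem mulCoeff_ne_zero_iff {I J K : Set (simples cs)} :
    mulCoeff cs I J K ≠ 0 ↔ ∃ d ∈ doubleReps cs I J, interConj cs I J d = K := by
  rw [mulCoeff, Ne, Set.ncard_eq_zero (Set.toFinite _), ← Ne, ← Set.nonempty_iff_ne_empty]
  rfl

theorem subset_of_mulCoeff_ne_zero {I J K : Set (simples cs)} (h : mulCoeff cs I J K ≠ 0) :
    K ⊆ J := by
  obtain ⟨d, -, rfl⟩ := (mulCoeff_ne_zero_iff cs).1 h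
  exact interConj_subset cs I J d

theorem subConj_of_mulCoeff_ne_zero {I J K : Set (simples cs)} (h : mulCoeff cs I J K ≠ 0) :
    SubConj cs K I := by
  obtain ⟨d, -, rfl⟩ := (mulCoeff_ne_zero_iff cs).1 h
  exact subConj_interConj cs I J d

/-! ### The descent algebra and its basis -/

theorem mem_Feq_iff {a : descent cs} {I : Set (simples cs)} :
    I ∈ Feq cs a ↔ ∃ J, xi cs J a ≠ 0 ∧ SubConj cs I J :=
  exists_congr fun _ => and_congr_right fun _ => lamLE_iff cs

theorem mem_Feq_of_subset {a : descent cs} {I J : Set (simples cs)} (hJ : J ∈ Feq cs a)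
    (h : I ⊆ J) : I ∈ Feq cs a := by
  rw [mem_Feq_iff] at hJ ⊢
  exact hJ.imp fun K hK => ⟨hK.1, hK.2.mono_left h⟩

theorem x_mem_spanOf {F : Set (Set (simples cs))} {I : Set (simples cs)} (h : I ∈ F) :
    x cs I ∈ spanOf cs F :=
  Submodule.subset_span ⟨I, h, rfl⟩

theorem x_mem_descent (I : Set (simples cs)) : x cs I ∈ descent cs :=
  x_mem_spanOf cs (Set.mem_univ I)

theorem x_mul_x_mem_spanOf {F : Set (Set (simples cs))} {I J : Set (simples cs)}
    (h : ∀ K, mulCoeff cs I J K ≠ 0 → K ∈ F) : x cs I * x cs J ∈ spanOf cs F := by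
  rw [x_mul_x_eq_sum_mulCoeff]
  refine Submodule.sum_mem _ fun K _ => ?_
  by_cases h0 : mulCoeff cs I J K = 0
  · rw [h0, zero_smul]
    exact zero_mem _
  · exact nsmul_mem (x_mem_spanOf cs (h K h0)) _

theorem mul_mem_descent {a b : MonoidAlgebra ℚ W} (ha : a ∈ descent cs) (hb : b ∈ descent cs) :
    a * b ∈ descent cs := by
  refine Submodule.span_induction₂ (p := fun a b _ _ => a * b ∈ descent cs) ?_ ?_ ?_ ?_ ?_ ?_ ?_
    ha hb
  · rintro _ _ ⟨I, -, rfl⟩ ⟨J, -, rfl⟩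
    exact x_mul_x_mem_spanOf cs fun K _ => Set.mem_univ K
  · simp
  · simp
  · intro a b c _ _ _ h h'
    rw [add_mul]
    exact add_mem h h'
  · intro a b c _ _ _ h h'
    rw [mul_add]
    exact add_mem h h'
  · intro r a b _ _ h
    rw [smul_mul_assoc]
    exact Submodule.smul_mem _ r h
  · intro r a b _ _ h
    rw [mul_smul_comm]
    exact Submodule.smul_mem _ r h

theorem x_univ : x cs Set.univ = 1 := by
  have h : X cs Set.univ = {1} := by
    ext w
    constructor
    · intro hw
      have htop : parabolic cs Set.univ = ⊤ := by
        rw [parabolic, Set.image_univ, Subtype.range_coe, cs.subgroup_closure_range_simple]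
      exact eq_one_of_mem_parabolic_of_mem_X cs (htop ▸ Subgroup.mem_top w) hw
    · rintro rfl
      exact (mem_X_iff cs).2 fun s _ => eta_one cs s
  rw [x, Finset.sum_congr (by ext; simp [h] : _ = ({1} : Finset W)) fun _ _ => rfl,
    Finset.sum_singleton, map_one]

theorem one_mem_descent : (1 : MonoidAlgebra ℚ W) ∈ descent cs :=
  x_univ cs ▸ x_mem_descent cs Set.univ

/-- Every set of simple reflections is the set of ascents of some element. -/
theorem exists_mem_X_iff_subset (K : Set (simples cs)) : ∃ w, ∀ I, w ∈ X cs I ↔ I ⊆ K := by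
  -- An element of maximal length in the parabolic subgroup of the complement of `K`.
  obtain ⟨w, hw, hmax⟩ := Set.exists_max_image (parabolic cs Kᶜ : Set W) cs.length
    (Set.toFinite _) ⟨1, one_mem _⟩
  refine ⟨w, fun I => ?_⟩
  have key (s : simples cs) : eta cs w s = 0 ↔ s ∈ K := by
    constructor
    · intro h
      by_contra hs
      exact (hmax _ (mul_mem hw (coe_mem_parabolic cs hs))).not_gt
        ((eta_eq_zero_iff cs (isReflection_coe cs s)).1 h)
    · intro hs
      by_contra h
      obtain ⟨t, ht, e⟩ := exists_eta_ne_zero cs (mem_parabolic_of_eta_ne_zero cs hw h)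
        (coe_ne_one cs s)
      rw [eta_coe_ne_zero_iff] at e
      exact ht (Subtype.ext e ▸ hs)
  rw [mem_X_iff]
  exact forall₂_congr fun s _ => key s

open scoped Classical in
theorem coeff_x (I : Set (simples cs)) (w : W) : (x cs I).coeff w = if w ∈ X cs I then 1 else 0 := by
  rw [x, MonoidAlgebra.coeff_sum, Finsupp.finsetSum_apply]
  simp [MonoidAlgebra.of_apply, Finsupp.single_apply]

/-- The coefficient at an element with ascent set exactly `K` only sees the `x_I` with `I ⊆ K`, so
the system is triangular. -/
theorem linearIndependent_x : LinearIndependent ℚ (x cs) := by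
  classical
  rw [Fintype.linearIndependent_iff]
  intro c hc K
  induction K using WellFoundedLT.induction with
  | ind K ih =>
    obtain ⟨w, hw⟩ := exists_mem_X_iff_subset cs K
    have h := DFunLike.congr_fun (congrArg MonoidAlgebra.coeff hc) w
    rw [MonoidAlgebra.coeff_sum, Finsupp.finsetSum_apply] at h
    rw [Finset.sum_eq_single K] at h
    · simpa [coeff_x, hw] using h
    · intro I _ hI
      by_cases hIK : I ⊆ K
      · simp [ih I (lt_of_le_of_ne hIK hI)]
      · simp [coeff_x, hw, hIK]
    · simp

/-! ### Ideals generated by positive elements -/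

theorem mul_x_mem_spanOf_Feq (a : descent cs) (J : Set (simples cs)) :
    (a : MonoidAlgebra ℚ W) * x cs J ∈ spanOf cs (Feq cs a) := by
  rw [← sum_xi, Finset.sum_mul]
  refine Submodule.sum_mem _ fun I _ => ?_
  rw [smul_mul_assoc]
  by_cases h : xi cs I a = 0
  · simp [h]
  · exact Submodule.smul_mem _ _ (x_mul_x_mem_spanOf cs fun K hK =>
      (mem_Feq_iff cs).2 ⟨I, h, subConj_of_mulCoeff_ne_zero cs hK⟩)

theorem x_mul_mem_spanOf_Feq (a : descent cs) (J : Set (simples cs)) :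
    x cs J * (a : MonoidAlgebra ℚ W) ∈ spanOf cs (Feq cs a) := by
  rw [← sum_xi, Finset.mul_sum]
  refine Submodule.sum_mem _ fun I _ => ?_
  rw [mul_smul_comm]
  by_cases h : xi cs I a = 0
  · simp [h]
  · exact Submodule.smul_mem _ _ (x_mul_x_mem_spanOf cs fun K hK =>
      (mem_Feq_iff cs).2 ⟨I, h, subConj_of_subset cs (subset_of_mulCoeff_ne_zero cs hK)⟩)

theorem rightIdeal_le_spanOf_Feq (a : descent cs) : rightIdeal cs a ≤ spanOf cs (Feq cs a) := by
  refine (Submodule.map_span_le _ _ _).2 ?_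
  rintro _ ⟨J, -, rfl⟩
  exact mul_x_mem_spanOf_Feq cs a J

theorem leftIdeal_le_spanOf_Feq (a : descent cs) : leftIdeal cs a ≤ spanOf cs (Feq cs a) := by
  refine (Submodule.map_span_le _ _ _).2 ?_
  rintro _ ⟨J, -, rfl⟩
  exact x_mul_mem_spanOf_Feq cs a J

theorem mul_x_eq_sum (a : descent cs) (J : Set (simples cs)) :
    (a : MonoidAlgebra ℚ W) * x cs J =
      ∑ K, (∑ I, xi cs I a * mulCoeff cs I J K) • x cs K := by
  rw [← sum_xi, Finset.sum_mul]
  simp only [Finset.sum_smul, smul_mul_assoc, x_mul_x_eq_sum_mulCoeff, Finset.smul_sum]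
  rw [Finset.sum_comm]
  simp only [mul_smul, Nat.cast_smul_eq_nsmul]

/-- For `a ∈ Σ⁺(W)`, left multiplication by `a` is triangular on the `x_J` for inclusion, with
nonzero diagonal coefficients at the members of `F_eq(a)`. -/
theorem x_mem_rightIdeal {a : descent cs} (ha : a ∈ positive cs) {J : Set (simples cs)}
    (hJ : J ∈ Feq cs a) : x cs J ∈ rightIdeal cs a := by
  classical
  induction J using WellFoundedLT.induction with
  | ind J ih =>
    have hmem : (a : MonoidAlgebra ℚ W) * x cs J ∈ rightIdeal cs a :=
      ⟨x cs J, x_mem_descent cs J, rfl⟩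
    rw [mul_x_eq_sum, ← Finset.add_sum_erase _ _ (Finset.mem_univ J)] at hmem
    have hrest := (Submodule.add_mem_iff_left _ (Submodule.sum_mem _ fun K hK => ?_)).1 hmem
    · refine (Submodule.smul_mem_iff _ (ne_of_gt ?_)).1 hrest
      obtain ⟨I, hI, hsub⟩ := (mem_Feq_iff cs).1 hJ
      -- Positivity of `a` is essential here: no term can cancel the one at `I`.
      refine Finset.sum_pos' (fun K _ => mul_nonneg (ha K) (Nat.cast_nonneg _))
        ⟨I, Finset.mem_univ I, mul_pos (lt_of_le_of_ne (ha I) hI.symm) ?_⟩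
      exact Nat.cast_pos.2 (Nat.pos_of_ne_zero
        ((mulCoeff_ne_zero_iff cs).2 (exists_interConj_eq cs hsub)))
    · by_cases hsub : K ⊆ J
      · exact Submodule.smul_mem _ _ (ih K (lt_of_le_of_ne hsub (Finset.ne_of_mem_erase hK))
          (mem_Feq_of_subset cs hJ hsub))
      · rw [Finset.sum_eq_zero, zero_smul]
        · exact zero_mem _
        · intro I _
          rw [not_imp_comm.1 (subset_of_mulCoeff_ne_zero cs) hsub, Nat.cast_zero, mul_zero]

theorem rightIdeal_eq_spanOf_Feq {a : descent cs} (ha : a ∈ positive cs) :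
    rightIdeal cs a = spanOf cs (Feq cs a) := by
  refine (rightIdeal_le_spanOf_Feq cs a).antisymm (Submodule.span_le.2 ?_)
  rintro _ ⟨J, hJ, rfl⟩
  exact x_mem_rightIdeal cs ha hJ

/-- Conjugation gives an injection of the finite set `S` into itself, hence a surjection. -/
theorem eq_univ_of_subConj_univ {J : Set (simples cs)} (h : SubConj cs Set.univ J) :
    J = Set.univ := by
  obtain ⟨g, hg⟩ := h
  choose f hf e using fun s => hg s (Set.mem_univ s)
  have hinj : Function.Injective f := by
    intro s t hst
    have h := (e s).symm.trans ((congrArg Subtype.val hst).trans (e t))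
    exact Subtype.ext (mul_left_cancel (mul_right_cancel h))
  refine Set.eq_univ_of_forall fun t => ?_
  obtain ⟨s, rfl⟩ := Finite.surjective_of_injective hinj t
  exact hf s

theorem univ_mem_Feq_iff (a : descent cs) : Set.univ ∈ Feq cs a ↔ xi cs Set.univ a ≠ 0 := by
  rw [mem_Feq_iff]
  constructor
  · rintro ⟨J, hJ, h⟩
    rwa [eq_univ_of_subConj_univ cs h] at hJ
  · exact fun h => ⟨Set.univ, h, subConj_of_subset cs subset_rfl⟩

theorem isInvertible_iff {a : descent cs} (ha : a ∈ positive cs) :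
    IsInvertible cs a ↔ 0 < xi cs Set.univ a := by
  rw [(ha Set.univ).lt_iff_ne', ← univ_mem_Feq_iff]
  constructor
  · rintro ⟨b, hb, -⟩
    have h1 : x cs Set.univ ∈ rightIdeal cs a := ⟨b, b.2, hb.trans (x_univ cs).symm⟩
    rw [rightIdeal_eq_spanOf_Feq cs ha] at h1
    by_contra h
    exact (linearIndependent_x cs).notMem_span_image h h1
  · intro h
    obtain ⟨b, hb, e⟩ := x_mem_rightIdeal cs ha h
    rw [x_univ] at e
    -- In a Noetherian ring a one-sided inverse is two-sided.
    have : IsNoetherianRing (MonoidAlgebra ℚ W) := by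
      have : Module.Finite ℚ (MonoidAlgebra ℚ W) :=
        Module.Finite.equiv (MonoidAlgebra.coeffLinearEquiv ℚ).symm
      exact IsNoetherianRing.of_finite ℚ _
    exact ⟨⟨b, hb⟩, e, mul_eq_one_symm e⟩

theorem xi_sum {ι : Type*} (s : Finset ι) (a : ι → descent cs) (I : Set (simples cs)) :
    xi cs I (∑ i ∈ s, a i) = ∑ i ∈ s, xi cs I (a i) := by
  simp only [xi, map_sum, Finsupp.finsetSum_apply]

theorem sum_mem_positive {ι : Type*} {s : Finset ι} {a : ι → descent cs}
    (ha : ∀ i ∈ s, a i ∈ positive cs) : ∑ i ∈ s, a i ∈ positive cs := fun I =>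
  xi_sum cs s a I ▸ Finset.sum_nonneg fun i hi => ha i hi I

/-- Non-negative coefficients cannot cancel, so the support of the sum is the union of the supports.
-/
theorem Feq_sum {ι : Type*} [Fintype ι] {a : ι → descent cs} (ha : ∀ i, a i ∈ positive cs) :
    Feq cs (∑ i, a i) = ⋃ i, Feq cs (a i) := by
  ext I
  simp only [Set.mem_iUnion, mem_Feq_iff, xi_sum, Ne,
    Finset.sum_eq_zero_iff_of_nonneg fun i _ => ha i _]
  simp only [Finset.mem_univ, true_imp_iff, not_forall]
  constructor
  · rintro ⟨J, ⟨i, hi⟩, h⟩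
    exact ⟨i, J, hi, h⟩
  · rintro ⟨i, J, hi, h⟩
    exact ⟨J, ⟨i, hi⟩, h⟩

theorem iSup_rightIdeal {ι : Type*} [Fintype ι] {a : ι → descent cs}
    (ha : ∀ i, a i ∈ positive cs) :
    ⨆ i, rightIdeal cs (a i) = rightIdeal cs (∑ i, a i) := by
  rw [rightIdeal_eq_spanOf_Feq cs (sum_mem_positive cs fun i _ => ha i), Feq_sum cs ha, spanOf,
    Set.image_iUnion, Submodule.span_iUnion]
  exact iSup_congr fun i => rightIdeal_eq_spanOf_Feq cs (ha i)

end Finite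

end DescentAlgebra

/-- The first three conjuncts say that `Σ(W)` is a unital subalgebra of the rational group algebra
with basis `(x_I)`. -/
theorem mainTheorem6 {B : Type*} {M : CoxeterMatrix B} {W : Type*} [Group W] [Finite W]
    (cs : CoxeterSystem M W) :
    LinearIndependent ℚ (DescentAlgebra.x cs) ∧
    (1 : MonoidAlgebra ℚ W) ∈ DescentAlgebra.descent cs ∧
    (∀ a ∈ DescentAlgebra.descent cs, ∀ b ∈ DescentAlgebra.descent cs,
      a * b ∈ DescentAlgebra.descent cs) ∧
    (∀ a ∈ DescentAlgebra.positive cs,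
      DescentAlgebra.rightIdeal cs a = DescentAlgebra.spanOf cs (DescentAlgebra.Feq cs a) ∧
      DescentAlgebra.leftIdeal cs a ≤ DescentAlgebra.rightIdeal cs a ∧
      (DescentAlgebra.IsInvertible cs a ↔ 0 < DescentAlgebra.xi cs Set.univ a)) ∧
    (∀ (r : ℕ) (a : Fin r → DescentAlgebra.descent cs),
      (∀ i, a i ∈ DescentAlgebra.positive cs) →
        (∑ i, a i) ∈ DescentAlgebra.positive cs ∧
        (⨆ i, DescentAlgebra.rightIdeal cs (a i)) =
          DescentAlgebra.rightIdeal cs (∑ i, a i)) :=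
  ⟨DescentAlgebra.linearIndependent_x cs, DescentAlgebra.one_mem_descent cs,
    fun _ ha _ hb => DescentAlgebra.mul_mem_descent cs ha hb,
    fun a ha => ⟨DescentAlgebra.rightIdeal_eq_spanOf_Feq cs ha,
      DescentAlgebra.rightIdeal_eq_spanOf_Feq cs ha ▸ DescentAlgebra.leftIdeal_le_spanOf_Feq cs a,
      DescentAlgebra.isInvertible_iff cs ha⟩,
    fun _ _ ha => ⟨DescentAlgebra.sum_mem_positive cs fun i _ => ha i,
      DescentAlgebra.iSup_rightIdeal cs ha⟩⟩
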